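/- Let $(\Omega,\Sigma,\mu)$ and $(\Omega',\Sigma',\nu)$ be complete $\sigma$-finite measure spaces. A \emph{Köthe function space} $X=X(\mu)$ is a normed space (not necessarily complete) of $\mu$-a.e. equivalence classes of real-valued measurable functions such that: (i) if $|x|\le|y|$ a.e. with $x$ measurable and $y\in X$, then $x\in X$ and $\|x\|_X\le\|y\|_X$; (ii) every measurable set containing a.e. the supports of all functions of $X$ has $\mu$-null complement; (iii) if $0\le x_n\uparrow x$ a.e. with $x_n,x\in X$, then $\|x_n\|_X\to\|x\|_X$. The space $X$ is \emph{$\sigma$-order continuous} if $\|x_n\|_X\to0$ for all $x_n\in X$ with $0\le x_n\downarrow 0$ a.e. Let $X'$ be the dual of the normed space $X$, and let $X^\times$ be the space of classes of measurable functions $g$ such that $xg$ is integrable for all $x\in X$ and $\sup_{\|x\|_X\le1}\bigl|\int xg\,d\mu\bigr|<\infty$. For $1\le p<\infty$ put $X^{1/p}=\{x : |x|^p\in X\}$ and $\|x\|_{X^{1/p}}=\bigl\||x|^p\bigr\|_X^{1/p}$. For $p=\infty$ we use the conventions $X^{1/\infty}=L_\infty(\mu)$ with its usual norm, $\bigl(\sum_k|x_k|^\infty\bigr)^{1/\infty}=\max_k|x_k|$,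 and $\varphi(|x|^\infty)^{1/\infty}=\|x\|_{L_\infty(\mu)}$. Let $X=X(\mu)$ and $Y=Y(\nu)$ be Köthe function spaces, let $1\le r<\infty$ and $\frac1r+\frac1{r'}=1$, and let $\mathbb K=\mathbb R$ or $\mathbb C$. Let $u:X^{1/r}\times Y^{1/r'}\to\mathbb K$ be a homogeneous form, i.e. $u(\lambda x,y)=u(x,\lambda y)=\lambda u(x,y)$ for all real $\lambda\ge0$, $x\in X^{1/r}$, $y\in Y^{1/r'}$. Suppose that for all $n$ and all $x_1,\dots,x_n\in X^{1/r}$, $y_1,\dots,y_n\in Y^{1/r'}$ $$\sum_{k=1}^n|u(x_k,y_k)|\le\Bigl\|\Bigl(\sum_{k=1}^n|x_k|^r\Bigr)^{1/r}\Bigr\|_{X^{1/r}}\Bigl\|\Bigl(\sum_{k=1}^n|y_k|^{r'}\Bigr)^{1/r'}\Bigr\|_{Y^{1/r'}}.$$ Then there are positive functionals $\varphi\in X'$ with $\|\varphi\|_{X'}\le1$ and $\psi\in Y'$ with $\|\psi\|_{Y'}\le1$ such that $$|u(x,y)|\le\varphi\bigl(|x|^r\bigr)^{1/r}\,\psi\bigl(|y|^{r'}\bigr)^{1/r'}\qquad\text{for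 all }x\in X^{1/r},\ y\in Y^{1/r'}.$$ Moreover, if $X$ is $\sigma$-order continuous, then $\varphi$ is a function in $X^\times$, i.e. $\varphi(x)=\int xg\,d\mu$ for all $x\in X$ and some $g\in X^\times$; and if $Y$ is $\sigma$-order continuous, then $\psi$ is, in the same sense, a function in $Y^\times$. -/

import Mathlib

open MeasureTheory Filter Topology
open scoped ENNReal

/-- A (normed, real) Köthe function space `X(μ)`: a vector space of `μ`-a.e. equivalence classes
of measurable real functions with a norm, which is solid with a monotone norm, has full support
and has the Fatou property inside the space. Completeness is not required. -/
structure KotheFunctionSpace {Ω : Type*} [MeasurableSpace Ω] (μ : Measure Ω) where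
  /-- the underlying vector space of classes of functions -/
  carrier : Submodule ℝ (Ω →ₘ[μ] ℝ)
  /-- the norm -/
  nrm : carrier → ℝ
  nrm_nonneg : ∀ x, 0 ≤ nrm x
  nrm_eq_zero_iff : ∀ x, nrm x = 0 ↔ x = 0
  nrm_smul : ∀ (c : ℝ) (x : carrier), nrm (c • x) = |c| * nrm x
  nrm_add_le : ∀ x y : carrier, nrm (x + y) ≤ nrm x + nrm y
  solid : ∀ x y : Ω →ₘ[μ] ℝ, (∀ᵐ ω ∂μ, |x ω| ≤ |y ω|) → y ∈ carrier → x ∈ carrier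
  nrm_mono : ∀ x y : carrier,
    (∀ᵐ ω ∂μ, |(x : Ω →ₘ[μ] ℝ) ω| ≤ |(y : Ω →ₘ[μ] ℝ) ω|) → nrm x ≤ nrm y
  /-- a measurable set that contains a.e. the supports of all functions of the space is conull -/
  support_eq : ∀ A : Set Ω, MeasurableSet A →
    (∀ x ∈ carrier, ∀ᵐ ω ∂μ, x ω ≠ 0 → ω ∈ A) → μ Aᶜ = 0
  /-- `0 ≤ xₙ ↑ z` a.e. with `xₙ` and `z` in the space implies `‖xₙ‖ → ‖z‖` -/
  fatou : ∀ (x : ℕ → carrier) (z : carrier),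
    (∀ᵐ ω ∂μ, ∀ n, 0 ≤ (x n : Ω →ₘ[μ] ℝ) ω) →
    (∀ᵐ ω ∂μ, Monotone fun n => (x n : Ω →ₘ[μ] ℝ) ω) →
    (∀ᵐ ω ∂μ, Tendsto (fun n => (x n : Ω →ₘ[μ] ℝ) ω) atTop (𝓝 ((z : Ω →ₘ[μ] ℝ) ω))) →
    Tendsto (fun n => nrm (x n)) atTop (𝓝 (nrm z))

namespace KotheFunctionSpace

variable {Ω : Type*} [MeasurableSpace Ω] {μ : Measure Ω}

instance instNormCarrier (X : KotheFunctionSpace μ) : Norm X.carrier := ⟨X.nrm⟩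

theorem normCore (X : KotheFunctionSpace μ) : NormedSpace.Core ℝ X.carrier where
  norm_nonneg := X.nrm_nonneg
  norm_smul := X.nrm_smul
  norm_triangle := X.nrm_add_le
  norm_eq_zero_iff := X.nrm_eq_zero_iff

noncomputable instance instNormedAddCommGroupCarrier (X : KotheFunctionSpace μ) :
    NormedAddCommGroup X.carrier := NormedAddCommGroup.ofCore X.normCore

noncomputable instance instNormedSpaceCarrier (X : KotheFunctionSpace μ) :
    NormedSpace ℝ X.carrier := NormedSpace.ofCore X.normCore

/-- `σ`-order continuity: `0 ≤ xₙ ↓ 0` a.e. in the space implies `‖xₙ‖ → 0`. -/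
def SigmaOrderContinuous (X : KotheFunctionSpace μ) : Prop :=
  ∀ x : ℕ → X.carrier,
    (∀ᵐ ω ∂μ, ∀ n, 0 ≤ (x n : Ω →ₘ[μ] ℝ) ω) →
    (∀ᵐ ω ∂μ, Antitone fun n => (x n : Ω →ₘ[μ] ℝ) ω) →
    (∀ᵐ ω ∂μ, Tendsto (fun n => (x n : Ω →ₘ[μ] ℝ) ω) atTop (𝓝 0)) →
    Tendsto (fun n => ‖x n‖) atTop (𝓝 0)

/-- The Köthe dual `X^×`: the (classes of) functions `g` for which `x g` is integrable for all
`x ∈ X` and `sup {|∫ x g| : ‖x‖ ≤ 1}` is finite. -/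
def kotheDual (X : KotheFunctionSpace μ) : Set (Ω →ₘ[μ] ℝ) :=
  {g | (∀ x ∈ X.carrier, Integrable (fun ω => x ω * g ω) μ) ∧
    BddAbove {t : ℝ | ∃ x : X.carrier, ‖x‖ ≤ 1 ∧ t = |∫ ω, (x : Ω →ₘ[μ] ℝ) ω * g ω ∂μ|}}

/-- A positive functional on `X`. -/
def IsPositive (X : KotheFunctionSpace μ) (φ : StrongDual ℝ X.carrier) : Prop :=
  ∀ x : X.carrier, (∀ᵐ ω ∂μ, 0 ≤ (x : Ω →ₘ[μ] ℝ) ω) → 0 ≤ φ x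

/-- The functional `φ` is integration against a function of the Köthe dual. -/
def IsFunctionInKotheDual (X : KotheFunctionSpace μ) (φ : StrongDual ℝ X.carrier) : Prop :=
  ∃ g ∈ X.kotheDual, ∀ x : X.carrier, φ x = ∫ ω, (x : Ω →ₘ[μ] ℝ) ω * g ω ∂μ

/-- The class of `|x|^p`, for a real exponent `p`. -/
noncomputable def absPow (p : ℝ) (x : Ω →ₘ[μ] ℝ) : Ω →ₘ[μ] ℝ :=
  AEEqFun.compMeasurable (fun t : ℝ => |t| ^ p) (by fun_prop) x

theorem coeFn_absPow (p : ℝ) (x : Ω →ₘ[μ] ℝ) : ∀ᵐ ω ∂μ, absPow p x ω = |x ω| ^ p :=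
  AEEqFun.coeFn_compMeasurable _ _ x

theorem toReal_pos_of_one_le (p : ℝ≥0∞) [h : Fact (1 ≤ p)] (hp : p ≠ ∞) : 0 < p.toReal :=
  ENNReal.toReal_pos (zero_lt_one.trans_le h.out).ne' hp

/-- The power `X^{1/p}`, `1 ≤ p ≤ ∞`: for `p < ∞` it consists of all `x` with `|x|^p ∈ X`, and
for `p = ∞` it is `L_∞(μ)`. -/
noncomputable def root (X : KotheFunctionSpace μ) (p : ℝ≥0∞) [Fact (1 ≤ p)] :
    Submodule ℝ (Ω →ₘ[μ] ℝ) where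
  carrier := {x | if p = ∞ then MemLp x ∞ μ else absPow p.toReal x ∈ X.carrier}
  zero_mem' := by
    simp only [Set.mem_ofPred_eq]
    split_ifs with hp
    · exact MemLp.zero.ae_eq AEEqFun.coeFn_zero.symm
    · have hpos := toReal_pos_of_one_le p hp
      refine X.solid _ 0 ?_ X.carrier.zero_mem
      filter_upwards [coeFn_absPow p.toReal (0 : Ω →ₘ[μ] ℝ),
        AEEqFun.coeFn_zero (μ := μ) (β := ℝ)] with ω h1 h2
      simp [h1, h2, Real.zero_rpow hpos.ne']
  add_mem' := by
    intro x y hx hy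
    simp only [Set.mem_ofPred_eq] at hx hy ⊢
    split_ifs at hx hy ⊢ with hp
    · exact (hx.add hy).ae_eq (AEEqFun.coeFn_add x y).symm
    · have hpos := toReal_pos_of_one_le p hp
      refine X.solid _ ((2 : ℝ) ^ p.toReal • (absPow p.toReal x + absPow p.toReal y)) ?_
        (X.carrier.smul_mem _ (X.carrier.add_mem hx hy))
      filter_upwards [coeFn_absPow p.toReal (x + y), coeFn_absPow p.toReal x,
        coeFn_absPow p.toReal y, AEEqFun.coeFn_add x y,
        AEEqFun.coeFn_add (absPow p.toReal x) (absPow p.toReal y),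
        AEEqFun.coeFn_smul ((2 : ℝ) ^ p.toReal) (absPow p.toReal x + absPow p.toReal y)]
        with ω h1 h2 h3 h4 h5 h6
      rw [h1, h6, Pi.smul_apply, h5, h4, Pi.add_apply, Pi.add_apply, h2, h3, smul_eq_mul]
      have ha : 0 ≤ |x ω| ^ p.toReal := by positivity
      have hb : 0 ≤ |y ω| ^ p.toReal := by positivity
      have h2p : (0 : ℝ) ≤ 2 ^ p.toReal := by positivity
      have hl : 0 ≤ |x ω + y ω| ^ p.toReal := by positivity
      rw [abs_of_nonneg hl, abs_of_nonneg (mul_nonneg h2p (add_nonneg ha hb))]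
      have key : ∀ a b : ℝ, |a| ≤ |b| →
          |a + b| ^ p.toReal ≤ 2 ^ p.toReal * |b| ^ p.toReal := by
        intro a b hab
        rw [← Real.mul_rpow (by norm_num) (abs_nonneg b)]
        refine Real.rpow_le_rpow (abs_nonneg _) ?_ hpos.le
        have := abs_add_le a b
        linarith
      rcases le_total |x ω| |y ω| with h | h
      · have := key _ _ h
        nlinarith [mul_nonneg h2p ha]
      · have := key _ _ h
        rw [add_comm] at this
        nlinarith [mul_nonneg h2p hb]
  smul_mem' := by
    intro c x hx
    simp only [Set.mem_ofPred_eq] at hx ⊢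
    split_ifs at hx ⊢ with hp
    · exact (hx.const_smul c).ae_eq (AEEqFun.coeFn_smul c x).symm
    · refine X.solid _ (|c| ^ p.toReal • absPow p.toReal x) ?_ (X.carrier.smul_mem _ hx)
      filter_upwards [coeFn_absPow p.toReal (c • x), coeFn_absPow p.toReal x,
        AEEqFun.coeFn_smul c x,
        AEEqFun.coeFn_smul (|c| ^ p.toReal) (absPow p.toReal x)] with ω h1 h2 h3 h4
      rw [h1, h4, Pi.smul_apply, h3, Pi.smul_apply, h2, smul_eq_mul, smul_eq_mul, abs_mul,
        Real.mul_rpow (abs_nonneg _) (abs_nonneg _)]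

theorem mem_root_top (X : KotheFunctionSpace μ) (p : ℝ≥0∞) [Fact (1 ≤ p)] (hp : p = ∞)
    (x : Ω →ₘ[μ] ℝ) : x ∈ X.root p ↔ MemLp x ∞ μ := by
  change (if p = ∞ then MemLp x ∞ μ else absPow p.toReal x ∈ X.carrier) ↔ _
  rw [if_pos hp]

theorem mem_root_finite (X : KotheFunctionSpace μ) (p : ℝ≥0∞) [Fact (1 ≤ p)] (hp : p ≠ ∞)
    (x : Ω →ₘ[μ] ℝ) : x ∈ X.root p ↔ absPow p.toReal x ∈ X.carrier := by
  change (if p = ∞ then MemLp x ∞ μ else absPow p.toReal x ∈ X.carrier) ↔ _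
  rw [if_neg hp]

/-- For `x ∈ X^{1/p}` with `p < ∞`, the element `|x|^p` of `X`. -/
noncomputable def rootPow (X : KotheFunctionSpace μ) (p : ℝ≥0∞) [Fact (1 ≤ p)] (hp : p ≠ ∞)
    (x : X.root p) : X.carrier :=
  ⟨absPow p.toReal x, (X.mem_root_finite p hp x).1 x.2⟩

open Classical in
/-- The norm of `X^{1/p}`: `‖|x|^p‖_X^{1/p}` for `p < ∞`, the `L_∞` norm for `p = ∞`. -/
noncomputable def rootNorm (X : KotheFunctionSpace μ) (p : ℝ≥0∞) [Fact (1 ≤ p)]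
    (x : X.root p) : ℝ :=
  if hp : p = ∞ then (eLpNorm (x : Ω →ₘ[μ] ℝ) ∞ μ).toReal else ‖X.rootPow p hp x‖ ^ (1 / p.toReal)

open Classical in
/-- `φ(|x|^p)^{1/p}` for `x ∈ X^{1/p}` and `p < ∞`; for `p = ∞` the `L_∞` norm of `x`. -/
noncomputable def rootEval (X : KotheFunctionSpace μ) (p : ℝ≥0∞) [Fact (1 ≤ p)]
    (φ : StrongDual ℝ X.carrier) (x : X.root p) : ℝ :=
  if hp : p = ∞ then (eLpNorm (x : Ω →ₘ[μ] ℝ) ∞ μ).toReal else φ (X.rootPow p hp x) ^ (1 / p.toReal)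

open Classical in
/-- Pointwise `(∑ₖ |xₖ|^p)^{1/p}` for `p < ∞`, and `maxₖ |xₖ|` for `p = ∞`
(with value `0` for the empty family). -/
noncomputable def lpSumFun (p : ℝ≥0∞) {n : ℕ} (x : Fin n → Ω →ₘ[μ] ℝ) (ω : Ω) : ℝ :=
  if p = ∞ then ⨆ k, |x k ω| else (∑ k, |x k ω| ^ p.toReal) ^ (1 / p.toReal)

theorem measurable_lpSumFun (p : ℝ≥0∞) {n : ℕ} (x : Fin n → Ω →ₘ[μ] ℝ) :
    Measurable (lpSumFun p x) := by
  have hx : ∀ k, Measurable fun ω => x k ω := fun k => (x k).measurable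
  unfold lpSumFun
  split_ifs
  · exact Measurable.iSup fun k => by fun_prop
  · fun_prop

/-- The class of `(∑ₖ |xₖ|^p)^{1/p}` (of `maxₖ |xₖ|` for `p = ∞`). -/
noncomputable def lpSum (p : ℝ≥0∞) {n : ℕ} (x : Fin n → Ω →ₘ[μ] ℝ) : Ω →ₘ[μ] ℝ :=
  AEEqFun.mk (lpSumFun p x) (measurable_lpSumFun p x).aestronglyMeasurable

theorem coeFn_lpSum (p : ℝ≥0∞) {n : ℕ} (x : Fin n → Ω →ₘ[μ] ℝ) :
    lpSum p x =ᵐ[μ] lpSumFun p x :=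
  AEEqFun.coeFn_mk _ _

theorem lpSum_mem (X : KotheFunctionSpace μ) (p : ℝ≥0∞) [Fact (1 ≤ p)] {n : ℕ}
    (x : Fin n → X.root p) : lpSum p (fun k => (x k : Ω →ₘ[μ] ℝ)) ∈ X.root p := by
  by_cases hp : p = ∞
  · rw [X.mem_root_top p hp]
    have hx : ∀ k, MemLp (x k : Ω →ₘ[μ] ℝ) ∞ μ := fun k => (X.mem_root_top p hp _).1 (x k).2
    have hS : MemLp (fun ω => ∑ k, |(x k : Ω →ₘ[μ] ℝ) ω|) ∞ μ :=
      memLp_finsetSum Finset.univ fun k _ => (hx k).abs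
    refine MemLp.ae_eq (coeFn_lpSum p _).symm (hS.mono
      (measurable_lpSumFun p _).aestronglyMeasurable (Eventually.of_forall fun ω => ?_))
    simp only [lpSumFun, if_pos hp, Real.norm_eq_abs]
    rw [abs_of_nonneg (Real.iSup_nonneg fun _ => abs_nonneg _),
      abs_of_nonneg (Finset.sum_nonneg fun _ _ => abs_nonneg _)]
    exact Real.iSup_le (fun k => Finset.single_le_sum
      (f := fun k => |(x k : Ω →ₘ[μ] ℝ) ω|) (fun _ _ => abs_nonneg _) (Finset.mem_univ k))
      (Finset.sum_nonneg fun _ _ => abs_nonneg _)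
  · rw [X.mem_root_finite p hp]
    have hpos := toReal_pos_of_one_le p hp
    refine X.solid _ (∑ k, absPow p.toReal (x k : Ω →ₘ[μ] ℝ)) ?_
      (X.carrier.sum_mem fun k _ => (X.mem_root_finite p hp _).1 (x k).2)
    filter_upwards [coeFn_absPow p.toReal (lpSum p (fun k => (x k : Ω →ₘ[μ] ℝ))),
      coeFn_lpSum p (fun k => (x k : Ω →ₘ[μ] ℝ)),
      AEEqFun.coeFn_finsetSum Finset.univ fun k => absPow p.toReal (x k : Ω →ₘ[μ] ℝ),
      ae_all_iff.2 fun k => coeFn_absPow p.toReal (x k : Ω →ₘ[μ] ℝ)] with ω h1 h2 h3 h4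
    have h0 : 0 ≤ ∑ k, |(x k : Ω →ₘ[μ] ℝ) ω| ^ p.toReal :=
      Finset.sum_nonneg fun _ _ => by positivity
    rw [h1, h2, h3, Finset.sum_apply]
    simp only [lpSumFun, if_neg hp, h4]
    rw [abs_of_nonneg (Real.rpow_nonneg h0 _), ← Real.rpow_mul h0,
      one_div_mul_cancel hpos.ne', Real.rpow_one]

/-- The element `(∑ₖ |xₖ|^p)^{1/p}` of `X^{1/p}` for `x₁, …, xₙ ∈ X^{1/p}`. -/
noncomputable def rootSum (X : KotheFunctionSpace μ) (p : ℝ≥0∞) [Fact (1 ≤ p)] {n : ℕ}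
    (x : Fin n → X.root p) : X.root p :=
  ⟨lpSum p (fun k => (x k : Ω →ₘ[μ] ℝ)), X.lpSum_mem p x⟩

end KotheFunctionSpace

/-- A homogeneous form: `u (λ x, y) = u (x, λ y) = λ u (x, y)` for all real `λ ≥ 0`. -/
def IsHomogeneousForm {𝕜 E F : Type*} [RCLike 𝕜] [AddCommGroup E] [Module ℝ E]
    [AddCommGroup F] [Module ℝ F] (u : E → F → 𝕜) : Prop :=
  ∀ (c : ℝ) (x : E) (y : F), 0 ≤ c →
    u (c • x) y = (c : 𝕜) * u x y ∧ u x (c • y) = (c : 𝕜) * u x y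

/-! ### Pointwise almost-everywhere calculus in the space -/

namespace KotheFunctionSpace

variable {Ω : Type*} [MeasurableSpace Ω] {μ : Measure Ω}

/-! Let `p`, `q` be the exponents `r`, `r'`, both finite. The map `x ↦ |x|^p` turns scaling by
`t^{1/p}` into scaling by `t`, and `p`-sums into sums. Absorbing weights `t_k ≥ 0` into the vectors,
the hypothesis and the weighted AM-GM inequality give `∑ t_k |u(x_k, y_k)| ≤ (1/p)‖∑ t_k |x_k|^p‖ +
(1/q)‖∑ t_k |y_k|^q‖`. This is the condition of the Mazur–Orlicz theorem on `X × Y` for the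
sublinear functional `(1/p)‖z⁺‖ + (1/q)‖w⁺‖`. It yields one linear functional below it that is at
least `|u(x, y)|` at `(|x|^p, |y|^q)`. Its two components, rescaled by `p` and `q`, are positive of
norm at most one because only positive parts enter the bound. Thus `|u(x, y)| ≤ (1/p) φ(|x|^p) +
(1/q) ψ(|y|^q)`, and dilating `x` and `y` optimally turns the sum into the product. For `r = 1` the
same argument runs on `X` alone, with `y` in the unit ball of `L_∞`, which is stable under finite
maxima. On a `σ`-order continuous space a positive functional is countably additive on indicators.
Indicators in the space cover almost everything, so it defines an absolutely continuous measure,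
finite on each piece of a countable partition; the Radon–Nikodym density is the required function.
-/

theorem coeFn_carrier_add (X : KotheFunctionSpace μ) (x y : X.carrier) :
    ∀ᵐ ω ∂μ, ((x + y : X.carrier) : Ω →ₘ[μ] ℝ) ω = (x : Ω →ₘ[μ] ℝ) ω + (y : Ω →ₘ[μ] ℝ) ω :=
  AEEqFun.coeFn_add (x : Ω →ₘ[μ] ℝ) y

theorem coeFn_carrier_sub (X : KotheFunctionSpace μ) (x y : X.carrier) :
    ∀ᵐ ω ∂μ, ((x - y : X.carrier) : Ω →ₘ[μ] ℝ) ω = (x : Ω →ₘ[μ] ℝ) ω - (y : Ω →ₘ[μ] ℝ) ω :=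
  AEEqFun.coeFn_sub (x : Ω →ₘ[μ] ℝ) y

theorem coeFn_carrier_smul (X : KotheFunctionSpace μ) (c : ℝ) (x : X.carrier) :
    ∀ᵐ ω ∂μ, ((c • x : X.carrier) : Ω →ₘ[μ] ℝ) ω = c * (x : Ω →ₘ[μ] ℝ) ω :=
  AEEqFun.coeFn_smul c (x : Ω →ₘ[μ] ℝ)

theorem coeFn_carrier_sum (X : KotheFunctionSpace μ) {ι : Type*} (s : Finset ι)
    (x : ι → X.carrier) :
    ∀ᵐ ω ∂μ, ((∑ i ∈ s, x i : X.carrier) : Ω →ₘ[μ] ℝ) ω = ∑ i ∈ s, (x i : Ω →ₘ[μ] ℝ) ω := by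
  have h := AEEqFun.coeFn_finsetSum s fun i => (x i : Ω →ₘ[μ] ℝ)
  filter_upwards [h] with ω hω
  rw [Submodule.coe_sum, hω, Finset.sum_apply]

/-- A measurable function dominated by an element of the space, as an element of the space. -/
theorem mk_mem_of_abs_le (X : KotheFunctionSpace μ) {f : Ω → ℝ} (hf : Measurable f)
    (x : X.carrier) (h : ∀ᵐ ω ∂μ, |f ω| ≤ |(x : Ω →ₘ[μ] ℝ) ω|) :
    AEEqFun.mk f hf.aestronglyMeasurable ∈ X.carrier := by
  refine X.solid _ x ?_ x.2
  filter_upwards [h, AEEqFun.coeFn_mk f hf.aestronglyMeasurable] with ω h1 h2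
  rwa [h2]

theorem carrier_ext (X : KotheFunctionSpace μ) {x y : X.carrier}
    (h : ∀ᵐ ω ∂μ, (x : Ω →ₘ[μ] ℝ) ω = (y : Ω →ₘ[μ] ℝ) ω) : x = y :=
  Subtype.ext (AEEqFun.ext h)

/-! ### Functionals on a σ-order continuous space: monotone convergence -/

theorem SigmaOrderContinuous.tendsto_of_monotone {X : KotheFunctionSpace μ}
    (hX : X.SigmaOrderContinuous) (φ : StrongDual ℝ X.carrier) (x : ℕ → X.carrier)
    (z : X.carrier) (hmono : ∀ᵐ ω ∂μ, Monotone fun n => (x n : Ω →ₘ[μ] ℝ) ω)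
    (hlim : ∀ᵐ ω ∂μ, Tendsto (fun n => (x n : Ω →ₘ[μ] ℝ) ω) atTop (𝓝 ((z : Ω →ₘ[μ] ℝ) ω))) :
    Tendsto (fun n => φ (x n)) atTop (𝓝 (φ z)) := by
  have hsub : ∀ᵐ ω ∂μ, ∀ n, ((z - x n : X.carrier) : Ω →ₘ[μ] ℝ) ω =
      (z : Ω →ₘ[μ] ℝ) ω - (x n : Ω →ₘ[μ] ℝ) ω :=
    ae_all_iff.2 fun n => X.coeFn_carrier_sub z (x n)
  -- The differences `z - x n` decrease to `0`, so `σ`-order continuity makes the convergence one in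
  -- norm.
  have h0 : Tendsto (fun n => ‖z - x n‖) atTop (𝓝 0) := by
    refine hX (fun n => z - x n) ?_ ?_ ?_
    · filter_upwards [hsub, hmono, hlim] with ω h1 h2 h3 n
      rw [h1]
      exact sub_nonneg.2 (h2.ge_of_tendsto h3 n)
    · filter_upwards [hsub, hmono] with ω h1 h2 m n hmn
      simp only [h1]
      exact sub_le_sub_left (h2 hmn) _
    · filter_upwards [hsub, hlim] with ω h1 h3
      simp only [h1]
      simpa using h3.const_sub ((z : Ω →ₘ[μ] ℝ) ω)
  have h1 : Tendsto (fun n => z - x n) atTop (𝓝 0) := tendsto_zero_iff_norm_tendsto_zero.2 h0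
  have h2 : Tendsto (fun n => φ z - φ (z - x n)) atTop (𝓝 (φ z - φ 0)) :=
    ((φ.continuous.tendsto 0).comp h1).const_sub _
  simpa using h2

theorem SigmaOrderContinuous.hasSum {X : KotheFunctionSpace μ}
    (hX : X.SigmaOrderContinuous) {φ : StrongDual ℝ X.carrier} (hφ : X.IsPositive φ)
    (x : ℕ → X.carrier) (z : X.carrier) (hx : ∀ᵐ ω ∂μ, ∀ n, 0 ≤ (x n : Ω →ₘ[μ] ℝ) ω)
    (hsum : ∀ᵐ ω ∂μ, HasSum (fun n => (x n : Ω →ₘ[μ] ℝ) ω) ((z : Ω →ₘ[μ] ℝ) ω)) :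
    HasSum (fun n => φ (x n)) (φ z) := by
  rw [hasSum_iff_tendsto_nat_of_nonneg fun n => hφ _ (hx.mono fun ω h => h n)]
  have hs : ∀ᵐ ω ∂μ, ∀ n, ((∑ i ∈ Finset.range n, x i : X.carrier) : Ω →ₘ[μ] ℝ) ω =
      ∑ i ∈ Finset.range n, (x i : Ω →ₘ[μ] ℝ) ω :=
    ae_all_iff.2 fun n => X.coeFn_carrier_sum (Finset.range n) x
  have h := hX.tendsto_of_monotone φ (fun n => ∑ i ∈ Finset.range n, x i) z ?_ ?_
  · simpa only [map_sum] using h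
  · filter_upwards [hs, hx] with ω h1 h2
    simp only [h1]
    exact monotone_nat_of_le_succ fun n => by
      rw [Finset.sum_range_succ]; exact le_add_of_nonneg_right (h2 n)
  · filter_upwards [hs, hsum] with ω h1 h2
    simp only [h1]
    exact h2.tendsto_sum_nat

/-! ### Exhausting the measure space by indicators in the space -/

/-- The class of the indicator function of a measurable set. -/
noncomputable def ind (μ : Measure Ω) {A : Set Ω} (hA : MeasurableSet A) : Ω →ₘ[μ] ℝ :=
  AEEqFun.mk (A.indicator 1) (measurable_one.indicator hA).aestronglyMeasurable

theorem coeFn_ind {A : Set Ω} (hA : MeasurableSet A) :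
    ∀ᵐ ω ∂μ, ind μ hA ω = A.indicator 1 ω :=
  AEEqFun.coeFn_mk _ _

theorem ind_mem_of_subset (X : KotheFunctionSpace μ) {A B : Set Ω} (hA : MeasurableSet A)
    (hB : MeasurableSet B) (hAB : A ⊆ B) (h : ind μ hB ∈ X.carrier) : ind μ hA ∈ X.carrier := by
  refine X.solid _ _ ?_ h
  filter_upwards [coeFn_ind (μ := μ) hA, coeFn_ind (μ := μ) hB] with ω h1 h2
  rw [h1, h2]
  by_cases ha : ω ∈ A
  · simp [ha, hAB ha]
  · simp [ha]

/-- A Köthe function space over a `σ`-finite measure contains a sequence whose supports cover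
almost everything. -/
theorem exists_seq_ae_exists_ne_zero [SigmaFinite μ] (X : KotheFunctionSpace μ) :
    ∃ f : ℕ → X.carrier, ∀ᵐ ω ∂μ, ∃ n, (f n : Ω →ₘ[μ] ℝ) ω ≠ 0 := by
  -- A finite measure with the same null sets makes the supremum of the measures of supports finite,
  -- so a maximising sequence is informative.
  set ρ := μ.toFinite with hρ
  have hμρ : μ ≪ ρ := absolutelyContinuous_toFinite μ
  have hρμ : ρ ≪ μ := toFinite_absolutelyContinuous μ
  set D : X.carrier → Set Ω := fun x => {ω | (x : Ω →ₘ[μ] ℝ) ω ≠ 0} with hD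
  have hDm : ∀ x, MeasurableSet (D x) := fun x =>
    ((x : Ω →ₘ[μ] ℝ).measurable (measurableSet_singleton 0)).compl
  obtain ⟨v, -, hv, hvr⟩ := exists_seq_tendsto_sSup (S := Set.range fun x => ρ (D x))
    ⟨_, 0, rfl⟩ (OrderTop.bddAbove _)
  choose f hf using hvr
  refine ⟨f, ?_⟩
  set s := sSup (Set.range fun x => ρ (D x)) with hs
  have hAm : MeasurableSet (⋃ n, D (f n)) := MeasurableSet.iUnion fun n => hDm _
  have hkey : ∀ x ∈ X.carrier, ∀ᵐ ω ∂μ, x ω ≠ 0 → ω ∈ ⋃ n, D (f n) := by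
    intro x hx
    refine hμρ.ae_le ?_
    have hN : ρ (D ⟨x, hx⟩ \ ⋃ n, D (f n)) = 0 := by
      -- `N` is the part of the support of `x` missed by the maximising sequence. The support of `|f
      -- n| + |x|` contains both `D (f n)` and `N`, so `ρ N > 0` would push its measure beyond the
      -- supremum for large `n`.
      set N := D ⟨x, hx⟩ \ ⋃ n, D (f n) with hNdef
      have hle : ∀ n, v n + ρ N ≤ s := by
        intro n
        have hmem : |(f n : Ω →ₘ[μ] ℝ)| + |x| ∈ X.carrier := by
          refine X.carrier.add_mem (X.solid _ (f n) ?_ (f n).2) (X.solid _ x ?_ hx)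
          · filter_upwards [AEEqFun.coeFn_abs (f n : Ω →ₘ[μ] ℝ)] with ω h
            rw [h, abs_abs]
          · filter_upwards [AEEqFun.coeFn_abs x] with ω h
            rw [h, abs_abs]
        have hsub : (D (f n) ∪ N : Set Ω) ≤ᵐ[ρ] D ⟨_, hmem⟩ := by
          refine hρμ.ae_le ?_
          filter_upwards [AEEqFun.coeFn_abs (f n : Ω →ₘ[μ] ℝ), AEEqFun.coeFn_abs x,
            AEEqFun.coeFn_add |(f n : Ω →ₘ[μ] ℝ)| |x|] with ω h1 h2 h3 hω
          change (|(f n : Ω →ₘ[μ] ℝ)| + |x| : Ω →ₘ[μ] ℝ) ω ≠ 0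
          rw [h3, Pi.add_apply, h1, h2]
          rcases hω with hω | hω
          · have := abs_pos.2 (show (f n : Ω →ₘ[μ] ℝ) ω ≠ 0 from hω)
            positivity
          · have := abs_pos.2 (show x ω ≠ 0 from hω.1)
            positivity
        have hdisj : Disjoint (D (f n)) N :=
          Set.disjoint_left.2 fun ω h h' => h'.2 (Set.mem_iUnion.2 ⟨n, h⟩)
        calc v n + ρ N = ρ (D (f n) ∪ N) := by
              rw [measure_union hdisj ((hDm _).diff hAm)]
              exact congrArg (· + ρ N) (hf n).symm
          _ ≤ ρ (D ⟨_, hmem⟩) := measure_mono_ae hsub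
          _ ≤ s := le_sSup ⟨_, rfl⟩
      have hlim : s + ρ N ≤ s := le_of_tendsto' (hv.add_const _) hle
      have hfin : s ≠ ∞ := ne_top_of_le_ne_top (measure_ne_top ρ Set.univ)
        (sSup_le (by rintro _ ⟨x, rfl⟩; exact measure_mono (Set.subset_univ _)))
      exact le_zero_iff.1 (ENNReal.le_of_add_le_add_left hfin (by simpa using hlim))
    refine mem_of_superset (compl_mem_ae_iff.2 hN) ?_
    intro ω hω hxω
    by_contra hcon
    exact hω ⟨hxω, hcon⟩
  have h0 := X.support_eq _ hAm hkey
  have := compl_mem_ae_iff.2 h0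
  rw [compl_compl] at this
  filter_upwards [this] with ω hω
  exact Set.mem_iUnion.1 hω

/-- A Köthe function space over a `σ`-finite measure contains the indicators of the members of a
countable measurable partition of almost everything. -/
theorem exists_partition_ind_mem [SigmaFinite μ] (X : KotheFunctionSpace μ) :
    ∃ (B : ℕ → Set Ω) (hB : ∀ n, MeasurableSet (B n)), Pairwise (Function.onFun Disjoint B) ∧
      (∀ n, ind μ (hB n) ∈ X.carrier) ∧ ∀ᵐ ω ∂μ, ∃ n, ω ∈ B n := by
  obtain ⟨f, hf⟩ := X.exists_seq_ae_exists_ne_zero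
  -- With `j` coding a pair `(n, k)`, this is the set where `k |f n| ≥ 1`: its indicator is
  -- dominated by `k |f n|`, and these sets exhaust the support of `f n`.
  set E : ℕ → Set Ω := fun j =>
    {ω | 1 ≤ ((Nat.unpair j).2 : ℝ) * |(f (Nat.unpair j).1 : Ω →ₘ[μ] ℝ) ω|} with hE
  have hEm : ∀ j, MeasurableSet (E j) := fun j =>
    measurableSet_le measurable_const
      ((f (Nat.unpair j).1 : Ω →ₘ[μ] ℝ).measurable.norm.const_mul _)
  have hEX : ∀ j, ind μ (hEm j) ∈ X.carrier := by
    intro j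
    refine X.solid _ (((Nat.unpair j).2 : ℝ) • f (Nat.unpair j).1 : X.carrier) ?_ (Subtype.prop _)
    filter_upwards [coeFn_ind (μ := μ) (hEm j),
      X.coeFn_carrier_smul ((Nat.unpair j).2 : ℝ) (f (Nat.unpair j).1)] with ω h1 h2
    rw [h1, h2]
    by_cases hω : ω ∈ E j
    · have : 1 ≤ ((Nat.unpair j).2 : ℝ) * |(f (Nat.unpair j).1 : Ω →ₘ[μ] ℝ) ω| := hω
      simpa [hω, abs_mul] using this
    · simp only [Set.indicator_of_notMem hω, abs_zero]
      positivity
  refine ⟨disjointed E, fun n => MeasurableSet.disjointed hEm n, disjoint_disjointed E,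
    fun n => X.ind_mem_of_subset _ (hEm n) (disjointed_subset E n) (hEX n), ?_⟩
  filter_upwards [hf] with ω ⟨n, hn⟩
  rw [← Set.mem_iUnion, iUnion_disjointed, Set.mem_iUnion]
  obtain ⟨k, hk⟩ := exists_nat_ge (|(f n : Ω →ₘ[μ] ℝ) ω|⁻¹)
  refine ⟨Nat.pair n k, ?_⟩
  simp only [hE, Set.mem_ofPred_eq, Nat.unpair_pair]
  have hpos := abs_pos.2 hn
  calc (1 : ℝ) = |(f n : Ω →ₘ[μ] ℝ) ω|⁻¹ * |(f n : Ω →ₘ[μ] ℝ) ω| :=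
        (inv_mul_cancel₀ hpos.ne').symm
    _ ≤ _ := mul_le_mul_of_nonneg_right hk hpos.le

/-! ### Integral representation of positive functionals -/

theorem hasSum_indicator_inter {S : Type*} {B : ℕ → Set S} (hB : Pairwise (Function.onFun Disjoint B))
    {A : Set S} {ω : S} (hω : ω ∈ A → ∃ n, ω ∈ B n) :
    HasSum (fun n => (A ∩ B n).indicator (1 : S → ℝ) ω) (A.indicator 1 ω) := by
  by_cases hA : ω ∈ A
  · obtain ⟨n, hn⟩ := hω hA
    have h : A.indicator (1 : S → ℝ) ω = (A ∩ B n).indicator 1 ω := by simp [hA, hn]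
    rw [h]
    refine hasSum_single n fun m hm => ?_
    have : ω ∉ B m := fun h' => Set.disjoint_left.1 (hB hm) h' hn
    simp [this]
  · simp [hA, hasSum_zero]

/-- Monotone convergence of the partial sums of indicators. It serves twice: for countable
additivity of each local measure, and for splitting a set along the partition. -/
theorem SigmaOrderContinuous.tsum_ind {X : KotheFunctionSpace μ}
    (hX : X.SigmaOrderContinuous) {φ : StrongDual ℝ X.carrier} (hφ : X.IsPositive φ)
    {B : ℕ → Set Ω} (hdisj : Pairwise (Function.onFun Disjoint B))
    {A : Set Ω} (hA : MeasurableSet A) (hAX : ind μ hA ∈ X.carrier)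
    (hAB : ∀ n, MeasurableSet (A ∩ B n)) (hABX : ∀ n, ind μ (hAB n) ∈ X.carrier)
    (hcov : ∀ᵐ ω ∂μ, ω ∈ A → ∃ n, ω ∈ B n) :
    ENNReal.ofReal (φ ⟨_, hAX⟩) = ∑' n, ENNReal.ofReal (φ ⟨_, hABX n⟩) := by
  have hae : ∀ᵐ ω ∂μ, ∀ n, ind μ (hAB n) ω = (A ∩ B n).indicator 1 ω :=
    ae_all_iff.2 fun n => coeFn_ind (hAB n)
  have h0 : ∀ᵐ ω ∂μ, ∀ n, 0 ≤ ind μ (hAB n) ω := by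
    filter_upwards [hae] with ω h n
    rw [h]
    exact Set.indicator_nonneg (fun _ _ => zero_le_one) _
  have hs : HasSum (fun n => φ ⟨_, hABX n⟩) (φ ⟨_, hAX⟩) := by
    refine hX.hasSum hφ _ _ h0 ?_
    filter_upwards [hae, coeFn_ind hA, hcov] with ω h1 h2 h3
    simp only [h1, h2]
    exact hasSum_indicator_inter hdisj h3
  rw [← hs.tsum_eq, ENNReal.ofReal_tsum_of_nonneg (fun n => hφ _ (h0.mono fun ω h => h n))
    hs.summable]

/-- A positive `σ`-order continuous functional is integration against a measure that is absolutely
continuous and finite on the members of a countable partition of almost everything. -/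
theorem SigmaOrderContinuous.exists_measure [SigmaFinite μ] {X : KotheFunctionSpace μ}
    (hX : X.SigmaOrderContinuous) {φ : StrongDual ℝ X.carrier} (hφ : X.IsPositive φ) :
    ∃ m : Measure Ω, SFinite m ∧ m ≪ μ ∧
      (∃ B : ℕ → Set Ω, (∀ n, MeasurableSet (B n)) ∧ (∀ᵐ ω ∂μ, ∃ n, ω ∈ B n) ∧ ∀ n, m (B n) ≠ ∞) ∧
      ∀ (A : Set Ω) (hA : MeasurableSet A) (hAX : ind μ hA ∈ X.carrier),
        m A = ENNReal.ofReal (φ ⟨_, hAX⟩) := by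
  obtain ⟨B, hBm, hdisj, hBX, hcov⟩ := X.exists_partition_ind_mem
  have hmem : ∀ n (A : Set Ω) (hA : MeasurableSet A), ind μ (hA.inter (hBm n)) ∈ X.carrier :=
    fun n A hA => X.ind_mem_of_subset _ (hBm n) Set.inter_subset_right (hBX n)
  have hind0 : ∀ (A : Set Ω) (hA : MeasurableSet A) (hAX : ind μ hA ∈ X.carrier), μ A = 0 →
      φ ⟨_, hAX⟩ = 0 := by
    intro A hA hAX h0
    rw [← map_zero φ]
    congr 1
    refine X.carrier_ext ?_
    filter_upwards [coeFn_ind hA, compl_mem_ae_iff.2 h0,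
      AEEqFun.coeFn_zero (μ := μ) (β := ℝ)] with ω h1 h2 h3
    rw [h1, Set.indicator_of_notMem h2]
    exact h3.symm
  -- The indicator of an arbitrary measurable set need not lie in `X`, so `φ` first defines a finite
  -- measure on each piece `B n`; the measure sought is the sum of these.
  set m' : ℕ → Measure Ω := fun n => Measure.ofMeasurable
    (fun A hA => ENNReal.ofReal (φ ⟨_, hmem n A hA⟩))
    (by rw [hind0 _ _ _ (by simp), ENNReal.ofReal_zero])
    (by
      intro A hA hAd
      -- Here the disjoint sets `A i` play the role of the partition, and the set being split is `(⋃
      -- i, A i) ∩ B n`.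
      have key := hX.tsum_ind hφ hAd ((MeasurableSet.iUnion hA).inter (hBm n))
        (hmem n _ (MeasurableSet.iUnion hA))
        (fun i => ((MeasurableSet.iUnion hA).inter (hBm n)).inter (hA i))
        (fun i => X.ind_mem_of_subset _ _ Set.inter_subset_left
          (hmem n _ (MeasurableSet.iUnion hA)))
        (Eventually.of_forall fun ω h => Set.mem_iUnion.1 h.1)
      rw [key]
      congr 1
      ext1 i
      congr 3
      have : ((⋃ i, A i) ∩ B n) ∩ A i = A i ∩ B n := by
        ext ω
        simp only [Set.mem_inter_iff, Set.mem_iUnion]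
        exact ⟨fun h => ⟨h.2, h.1.2⟩, fun h => ⟨⟨⟨i, h.1⟩, h.2⟩, h.1⟩⟩
      simp only [this]) with hm'
  have hm'a : ∀ n (A : Set Ω) (hA : MeasurableSet A),
      m' n A = ENNReal.ofReal (φ ⟨_, hmem n A hA⟩) := fun n A hA =>
    Measure.ofMeasurable_apply A hA
  have hfin : ∀ n, IsFiniteMeasure (m' n) := fun n =>
    ⟨by rw [hm'a n _ MeasurableSet.univ]; exact ENNReal.ofReal_lt_top⟩
  have hsum : ∀ (A : Set Ω) (hA : MeasurableSet A) (hAX : ind μ hA ∈ X.carrier),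
        Measure.sum m' A = ENNReal.ofReal (φ ⟨_, hAX⟩) := by
    intro A hA hAX
    rw [Measure.sum_apply _ hA, hX.tsum_ind hφ hdisj hA hAX (fun n => hA.inter (hBm n))
      (fun n => hmem n A hA) (hcov.mono fun ω h _ => h)]
    exact tsum_congr fun n => hm'a n A hA
  refine ⟨Measure.sum m', inferInstance, ?_, ⟨B, hBm, hcov, fun n => ?_⟩, hsum⟩
  · refine Measure.AbsolutelyContinuous.mk fun A hA h0 => ?_
    rw [Measure.sum_apply _ hA, ENNReal.tsum_eq_zero]
    intro n
    rw [hm'a n A hA, hind0 _ _ _ (measure_mono_null Set.inter_subset_left h0),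
      ENNReal.ofReal_zero]
  · rw [hsum _ (hBm n) (hBX n)]
    exact ENNReal.ofReal_ne_top

/-- Induction on `F` through simple functions and increasing limits. Every function occurring below
`F` is dominated by the class `x`, so solidity keeps it in the space and `φ` can be evaluated on it.
-/
theorem SigmaOrderContinuous.ofReal_apply_eq_lintegral {X : KotheFunctionSpace μ}
    (hX : X.SigmaOrderContinuous) {φ : StrongDual ℝ X.carrier} (hφ : X.IsPositive φ)
    {m : Measure Ω} (hmμ : m ≪ μ)
    (hm : ∀ (A : Set Ω) (hA : MeasurableSet A) (hAX : ind μ hA ∈ X.carrier),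
        m A = ENNReal.ofReal (φ ⟨_, hAX⟩))
    {F : Ω → ℝ≥0∞} (hF : Measurable F) :
    ∀ x : X.carrier, (∀ᵐ ω ∂μ, F ω ≠ ∞ ∧ (x : Ω →ₘ[μ] ℝ) ω = (F ω).toReal) →
      ENNReal.ofReal (φ x) = ∫⁻ ω, F ω ∂m := by
  refine Measurable.ennreal_induction (motive := fun F => ∀ x : X.carrier,
    (∀ᵐ ω ∂μ, F ω ≠ ∞ ∧ (x : Ω →ₘ[μ] ℝ) ω = (F ω).toReal) →
      ENNReal.ofReal (φ x) = ∫⁻ ω, F ω ∂m) ?_ ?_ ?_ hF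
  · intro c s hs x hx
    -- For `c = ∞` the class vanishes too, as `toReal` sends `∞` to `0`; the integral vanishes
    -- because finiteness of `F` forces `μ s = 0`, hence `m s = 0`.
    have hx0 : c = 0 ∨ c = ∞ → ENNReal.ofReal (φ x) = 0 := by
      intro hc
      have : x = 0 := by
        refine X.carrier_ext ?_
        filter_upwards [hx, AEEqFun.coeFn_zero (μ := μ) (β := ℝ)] with ω h1 h2
        rw [h1.2]
        refine Eq.trans ?_ h2.symm
        by_cases hω : ω ∈ s <;> rcases hc with rfl | rfl <;> simp [hω]
      rw [this, map_zero, ENNReal.ofReal_zero]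
    rw [lintegral_indicator_const hs]
    by_cases hc0 : c = 0
    · rw [hx0 (Or.inl hc0), hc0, zero_mul]
    by_cases hct : c = ∞
    · have h0 : μ s = 0 := by
        refine measure_eq_zero_iff_ae_notMem.2 (hx.mono fun ω h hω => h.1 ?_)
        simp [hω, hct]
      rw [hx0 (Or.inr hct), hmμ h0, mul_zero]
    · have hcpos : 0 < c.toReal := ENNReal.toReal_pos hc0 hct
      have hxi : ∀ᵐ ω ∂μ, (x : Ω →ₘ[μ] ℝ) ω = c.toReal * s.indicator 1 ω := by
        filter_upwards [hx] with ω h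
        rw [h.2]
        by_cases hω : ω ∈ s <;> simp [hω]
      have hsX : ind μ hs ∈ X.carrier := by
        refine X.solid _ (c.toReal⁻¹ • x : X.carrier) ?_ (Subtype.prop _)
        filter_upwards [hxi, coeFn_ind hs, X.coeFn_carrier_smul c.toReal⁻¹ x] with ω h1 h2 h3
        rw [h2, h3, h1, inv_mul_cancel_left₀ hcpos.ne']
      have hxe : x = c.toReal • (⟨_, hsX⟩ : X.carrier) := by
        refine X.carrier_ext ?_
        filter_upwards [hxi, coeFn_ind hs,
          X.coeFn_carrier_smul c.toReal (⟨_, hsX⟩ : X.carrier)] with ω h1 h2 h3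
        rw [h3, h1, h2]
      rw [hm s hs hsX, hxe, map_smul, smul_eq_mul, ENNReal.ofReal_mul hcpos.le,
        ENNReal.ofReal_toReal hct]
  · intro F G _ hF hG ihF ihG x hx
    have hFX := X.mk_mem_of_abs_le hF.ennreal_toReal x <| by
      filter_upwards [hx] with ω h
      have h1 := ENNReal.add_ne_top.1 h.1
      rw [h.2, Pi.add_apply, abs_of_nonneg ENNReal.toReal_nonneg,
        abs_of_nonneg ENNReal.toReal_nonneg]
      exact ENNReal.toReal_mono h.1 le_self_add
    have hGX := X.mk_mem_of_abs_le hG.ennreal_toReal x <| by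
      filter_upwards [hx] with ω h
      rw [h.2, Pi.add_apply, abs_of_nonneg ENNReal.toReal_nonneg,
        abs_of_nonneg ENNReal.toReal_nonneg]
      exact ENNReal.toReal_mono h.1 le_add_self
    have haF := AEEqFun.coeFn_mk (μ := μ) _ hF.ennreal_toReal.aestronglyMeasurable
    have haG := AEEqFun.coeFn_mk (μ := μ) _ hG.ennreal_toReal.aestronglyMeasurable
    have hxe : x = (⟨_, hFX⟩ : X.carrier) + ⟨_, hGX⟩ := by
      refine X.carrier_ext ?_
      filter_upwards [hx, haF, haG,
        X.coeFn_carrier_add (⟨_, hFX⟩ : X.carrier) ⟨_, hGX⟩] with ω h1 h2 h3 h4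
      have h5 := ENNReal.add_ne_top.1 h1.1
      rw [h4, h2, h3, h1.2, Pi.add_apply, ENNReal.toReal_add h5.1 h5.2]
    have e1 := ihF ⟨_, hFX⟩ (by
      filter_upwards [hx, haF] with ω h1 h2
      exact ⟨(ENNReal.add_ne_top.1 h1.1).1, h2⟩)
    have e2 := ihG ⟨_, hGX⟩ (by
      filter_upwards [hx, haG] with ω h1 h2
      exact ⟨(ENNReal.add_ne_top.1 h1.1).2, h2⟩)
    simp only [Pi.add_apply]
    rw [lintegral_add_left hF, ← e1, ← e2, hxe, map_add, ENNReal.ofReal_add]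
    · exact hφ _ (haF.mono fun ω h => by rw [h]; exact ENNReal.toReal_nonneg)
    · exact hφ _ (haG.mono fun ω h => by rw [h]; exact ENNReal.toReal_nonneg)
  · intro F hF hmono ih x hx
    have hFX : ∀ n, AEEqFun.mk _ (hF n).ennreal_toReal.aestronglyMeasurable ∈ X.carrier :=
      fun n => X.mk_mem_of_abs_le (hF n).ennreal_toReal x <| by
        filter_upwards [hx] with ω h
        rw [h.2, abs_of_nonneg ENNReal.toReal_nonneg, abs_of_nonneg ENNReal.toReal_nonneg]
        exact ENNReal.toReal_mono h.1 (le_iSup (fun n => F n ω) n)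
    have ha : ∀ᵐ ω ∂μ, ∀ n, AEEqFun.mk (μ := μ) _ (hF n).ennreal_toReal.aestronglyMeasurable ω =
        (F n ω).toReal := ae_all_iff.2 fun n => AEEqFun.coeFn_mk _ _
    have hne : ∀ᵐ ω ∂μ, ∀ n, F n ω ≠ ∞ := hx.mono fun ω h n =>
      ne_top_of_le_ne_top h.1 (le_iSup (fun n => F n ω) n)
    have hlim := hX.tendsto_of_monotone φ (fun n => ⟨_, hFX n⟩) x
      (by
        filter_upwards [ha, hne] with ω h1 h2 i j hij
        simp only [h1]
        exact ENNReal.toReal_mono (h2 j) (hmono hij ω))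
      (by
        filter_upwards [ha, hx] with ω h1 h2
        simp only [h1, h2.2]
        exact (ENNReal.tendsto_toReal h2.1).comp
          (tendsto_atTop_iSup fun i j hij => hmono hij ω))
    have e : ∀ n, ENNReal.ofReal (φ ⟨_, hFX n⟩) = ∫⁻ ω, F n ω ∂m := fun n =>
      ih n ⟨_, hFX n⟩ (by
        filter_upwards [ha, hne] with ω h1 h2
        exact ⟨h2 n, h1 n⟩)
    have hlim' := ENNReal.tendsto_ofReal hlim
    simp only [e] at hlim'
    rw [lintegral_iSup hF hmono]
    exact tendsto_nhds_unique hlim'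
      (tendsto_atTop_iSup fun i j hij => lintegral_mono (hmono hij))

/-- A positive functional on a `σ`-order continuous Köthe function space is integration against a
function of the Köthe dual. -/
theorem SigmaOrderContinuous.isFunctionInKotheDual [SigmaFinite μ] {X : KotheFunctionSpace μ}
    (hX : X.SigmaOrderContinuous) {φ : StrongDual ℝ X.carrier} (hφ : X.IsPositive φ) :
    X.IsFunctionInKotheDual φ := by
  obtain ⟨m, _, hmμ, ⟨B, hBm, hcov, hBfin⟩, hm⟩ := hX.exists_measure hφ
  set h := m.rnDeriv μ with hh
  have hhm : Measurable h := Measure.measurable_rnDeriv m μ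
  -- The density has finite integral over each `B n`, since `m (B n)` is finite, and the `B n` cover
  -- almost everything.
  have hhfin : ∀ᵐ ω ∂μ, h ω ≠ ∞ := by
    have hB : ∀ᵐ ω ∂μ, ∀ n, ω ∈ B n → h ω ≠ ∞ := by
      refine ae_all_iff.2 fun n => ?_
      rw [← ae_restrict_iff' (hBm n)]
      refine (ae_lt_top hhm ?_).mono fun ω h => h.ne
      exact ne_top_of_le_ne_top (hBfin n) (Measure.setLIntegral_rnDeriv_le _)
    filter_upwards [hB, hcov] with ω h1 ⟨n, h2⟩
    exact h1 n h2
  have hlin : ∀ x : X.carrier, (∀ᵐ ω ∂μ, 0 ≤ (x : Ω →ₘ[μ] ℝ) ω) →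
      ∫⁻ ω, ENNReal.ofReal ((x : Ω →ₘ[μ] ℝ) ω * (h ω).toReal) ∂μ = ENNReal.ofReal (φ x) := by
    intro x hx
    have hxm := (x : Ω →ₘ[μ] ℝ).measurable
    rw [hX.ofReal_apply_eq_lintegral hφ hmμ hm hxm.ennreal_ofReal x
      (hx.mono fun ω h => ⟨ENNReal.ofReal_ne_top, (ENNReal.toReal_ofReal h).symm⟩),
      ← lintegral_rnDeriv_mul hmμ hxm.ennreal_ofReal.aemeasurable]
    refine lintegral_congr_ae ?_
    filter_upwards [hx, hhfin] with ω h1 h2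
    rw [ENNReal.ofReal_mul h1, ENNReal.ofReal_toReal h2, mul_comm]
  have hpos : ∀ x : X.carrier, (∀ᵐ ω ∂μ, 0 ≤ (x : Ω →ₘ[μ] ℝ) ω) →
      Integrable (fun ω => (x : Ω →ₘ[μ] ℝ) ω * (h ω).toReal) μ ∧
      φ x = ∫ ω, (x : Ω →ₘ[μ] ℝ) ω * (h ω).toReal ∂μ := by
    intro x hx
    have hnn : 0 ≤ᵐ[μ] fun ω => (x : Ω →ₘ[μ] ℝ) ω * (h ω).toReal :=
      hx.mono fun ω h => mul_nonneg h ENNReal.toReal_nonneg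
    have hmeas : AEStronglyMeasurable (fun ω => (x : Ω →ₘ[μ] ℝ) ω * (h ω).toReal) μ :=
      ((x : Ω →ₘ[μ] ℝ).measurable.mul hhm.ennreal_toReal).aestronglyMeasurable
    refine ⟨(lintegral_ofReal_ne_top_iff_integrable hmeas hnn).1 ?_, ?_⟩
    · rw [hlin x hx]; exact ENNReal.ofReal_ne_top
    · rw [integral_eq_lintegral_of_nonneg_ae hnn hmeas, hlin x hx,
        ENNReal.toReal_ofReal (hφ x hx)]
  set g : Ω →ₘ[μ] ℝ := AEEqFun.mk _ hhm.ennreal_toReal.aestronglyMeasurable with hg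
  have hga : ∀ᵐ ω ∂μ, g ω = (h ω).toReal := AEEqFun.coeFn_mk _ _
  have hall : ∀ x : X.carrier, Integrable (fun ω => (x : Ω →ₘ[μ] ℝ) ω * g ω) μ ∧
      φ x = ∫ ω, (x : Ω →ₘ[μ] ℝ) ω * g ω ∂μ := by
    intro x
    have hxm := (x : Ω →ₘ[μ] ℝ).measurable
    have hpm : Measurable fun ω => max ((x : Ω →ₘ[μ] ℝ) ω) 0 := hxm.max measurable_const
    have hnm : Measurable fun ω => max (-(x : Ω →ₘ[μ] ℝ) ω) 0 := hxm.neg.max measurable_const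
    have hpX := X.mk_mem_of_abs_le hpm x (Eventually.of_forall fun ω => by
      rw [abs_of_nonneg (le_max_right _ _)]
      exact max_le (le_abs_self _) (abs_nonneg _))
    have hnX := X.mk_mem_of_abs_le hnm x (Eventually.of_forall fun ω => by
      rw [abs_of_nonneg (le_max_right _ _)]
      exact max_le (neg_le_abs _) (abs_nonneg _))
    have hpa := AEEqFun.coeFn_mk (μ := μ) _ hpm.aestronglyMeasurable
    have hna := AEEqFun.coeFn_mk (μ := μ) _ hnm.aestronglyMeasurable
    have hxe : x = (⟨_, hpX⟩ : X.carrier) - ⟨_, hnX⟩ := by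
      refine X.carrier_ext ?_
      filter_upwards [hpa, hna, X.coeFn_carrier_sub (⟨_, hpX⟩ : X.carrier) ⟨_, hnX⟩]
        with ω h1 h2 h3
      rw [h3, h1, h2]
      exact (max_zero_sub_max_neg_zero_eq_self _).symm
    obtain ⟨i1, e1⟩ := hpos ⟨_, hpX⟩ (hpa.mono fun ω h => by rw [h]; exact le_max_right _ _)
    obtain ⟨i2, e2⟩ := hpos ⟨_, hnX⟩ (hna.mono fun ω h => by rw [h]; exact le_max_right _ _)
    have hae : (fun ω => AEEqFun.mk (μ := μ) _ hpm.aestronglyMeasurable ω * (h ω).toReal -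
        AEEqFun.mk (μ := μ) _ hnm.aestronglyMeasurable ω * (h ω).toReal) =ᵐ[μ]
        fun ω => (x : Ω →ₘ[μ] ℝ) ω * g ω := by
      filter_upwards [hga, hpa, hna] with ω h1 h2 h3
      rw [h1, h2, h3, ← sub_mul, max_zero_sub_max_neg_zero_eq_self]
    refine ⟨(i1.sub i2).congr hae, ?_⟩
    rw [← integral_congr_ae hae, integral_sub i1 i2, ← e1, ← e2, ← map_sub, ← hxe]
  refine ⟨g, ⟨fun x hx => (hall ⟨x, hx⟩).1, ‖φ‖, ?_⟩, fun x => (hall x).2⟩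
  rintro _ ⟨x, hx, rfl⟩
  rw [← (hall x).2]
  exact (φ.le_opNorm x).trans (mul_le_of_le_one_right (norm_nonneg _) hx)

end KotheFunctionSpace

/-! ### Hahn–Banach and Young inequality tools -/

/-- The **Mazur–Orlicz theorem**: a family of lower bounds is respected by some linear functional
dominated by a sublinear one as soon as all its nonnegative combinations are. -/
theorem exists_linear_le_sublinear_of_family {E I : Type*} [AddCommGroup E] [Module ℝ E]
    (ρ : E → ℝ) (ρ_hom : ∀ c : ℝ, 0 < c → ∀ x, ρ (c • x) = c * ρ x)
    (ρ_add : ∀ x y, ρ (x + y) ≤ ρ x + ρ y) (a : I → E) (b : I → ℝ)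
    (h : ∀ (n : ℕ) (t : Fin n → ℝ) (i : Fin n → I), (∀ k, 0 ≤ t k) →
      ∑ k, t k * b (i k) ≤ ρ (∑ k, t k • a (i k))) :
    ∃ Φ : E →ₗ[ℝ] ℝ, (∀ x, Φ x ≤ ρ x) ∧ ∀ i, b i ≤ Φ (a i) := by
  have ρ_zero : ρ 0 = 0 := by
    have := ρ_hom 2 (by norm_num) 0
    rw [smul_zero] at this
    linarith
  -- The convex cone generated by the pairs `(a i, b i)`; the hypothesis says `c.2 ≤ ρ c.1` on it.
  set C : Set (E × ℝ) := {c | ∃ (n : ℕ) (t : Fin n → ℝ) (i : Fin n → I), (∀ k, 0 ≤ t k) ∧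
    c = (∑ k, t k • a (i k), ∑ k, t k * b (i k))} with hC
  have C_zero : (0 : E × ℝ) ∈ C := ⟨0, Fin.elim0, Fin.elim0, fun k => k.elim0,
    Prod.ext (by simp) (by simp)⟩
  have C_gen : ∀ i, (a i, b i) ∈ C := fun i =>
    ⟨1, fun _ => 1, fun _ => i, fun _ => zero_le_one, by simp⟩
  have C_add : ∀ c ∈ C, ∀ d ∈ C, c + d ∈ C := by
    rintro _ ⟨n, t, i, ht, rfl⟩ _ ⟨m, s, j, hs, rfl⟩
    refine ⟨n + m, Fin.append t s, Fin.append i j, fun k => ?_, ?_⟩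
    · refine Fin.addCases (fun l => ?_) (fun l => ?_) k
      · simpa using ht l
      · simpa using hs l
    · simp [Fin.sum_univ_add]
  have C_smul : ∀ r : ℝ, 0 < r → ∀ c ∈ C, r • c ∈ C := by
    rintro r hr _ ⟨n, t, i, ht, rfl⟩
    exact ⟨n, fun k => r * t k, i, fun k => mul_nonneg hr.le (ht k), by
      simp [Finset.smul_sum, Finset.mul_sum, mul_smul, mul_assoc]⟩
  have C_le : ∀ c ∈ C, c.2 ≤ ρ c.1 := by
    rintro _ ⟨n, t, i, ht, rfl⟩
    exact h n t i ht
  have : Nonempty C := ⟨⟨0, C_zero⟩⟩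
  -- This auxiliary functional is sublinear because `C` is a cone, and lies below `ρ` because `0 ∈
  -- C`. Taking `c = (a i, b i)` gives `N (-a i) ≤ -b i`, so any linear functional below `N`
  -- satisfies both requirements.
  set N : E → ℝ := fun x => ⨅ c : C, ρ (x + c.1.1) - c.1.2 with hN
  have bdd : ∀ x, BddBelow (Set.range fun c : C => ρ (x + c.1.1) - c.1.2) := by
    refine fun x => ⟨-ρ (-x), ?_⟩
    rintro _ ⟨c, rfl⟩
    have h1 := C_le c c.2
    have h2 := ρ_add (-x) (x + c.1.1)
    rw [neg_add_cancel_left] at h2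
    simp only
    linarith
  have N_le : ∀ x, ∀ c ∈ C, N x ≤ ρ (x + c.1) - c.2 := fun x c hc => ciInf_le (bdd x) ⟨c, hc⟩
  have N_smul_le : ∀ r : ℝ, 0 < r → ∀ x, N (r • x) ≤ r * N x := by
    intro r hr x
    rw [hN, Real.mul_iInf_of_nonneg hr.le]
    refine le_ciInf fun c => (N_le _ _ (C_smul r hr c c.2)).trans_eq ?_
    rw [Prod.smul_fst, Prod.smul_snd, ← smul_add, ρ_hom r hr, smul_eq_mul, mul_sub]
  obtain ⟨Φ, -, hΦ⟩ := exists_extension_of_le_sublinear (⊥ : E →ₗ.[ℝ] ℝ) N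
    (by
      intro r hr x
      refine le_antisymm (N_smul_le r hr x) ?_
      have h1 := N_smul_le r⁻¹ (inv_pos.2 hr) (r • x)
      rw [inv_smul_smul₀ hr.ne'] at h1
      calc r * N x ≤ r * (r⁻¹ * N (r • x)) := mul_le_mul_of_nonneg_left h1 hr.le
        _ = N (r • x) := mul_inv_cancel_left₀ hr.ne' _)
    (by
      intro x y
      refine le_ciInf_add_ciInf fun c d => (N_le _ _ (C_add c c.2 d d.2)).trans ?_
      have h1 := ρ_add (x + c.1.1) (y + d.1.1)
      rw [add_add_add_comm] at h1
      rw [Prod.fst_add, Prod.snd_add]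
      linarith)
    (by
      rintro ⟨x, hx⟩
      obtain rfl : x = 0 := (Submodule.mem_bot ℝ).1 hx
      have h0 : (⊥ : E →ₗ.[ℝ] ℝ) ⟨0, hx⟩ = 0 := map_zero (⊥ : E →ₗ.[ℝ] ℝ).toFun
      rw [h0]
      refine le_ciInf fun c => ?_
      have := C_le c c.2
      rw [zero_add]
      linarith)
  refine ⟨Φ, fun x => (hΦ x).trans ((N_le x 0 C_zero).trans_eq (by simp)), fun i => ?_⟩
  have h1 := (hΦ (-a i)).trans (N_le _ _ (C_gen i))
  simp only [map_neg, neg_add_cancel, ρ_zero] at h1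
  linarith

theorem le_of_forall_pos_le_of_continuous {f : ℝ → ℝ} (hf : Continuous f) {U : ℝ}
    (h : ∀ ε, 0 < ε → U ≤ f ε) : U ≤ f 0 :=
  ge_of_tendsto ((hf.tendsto 0).mono_left (nhdsWithin_le_nhds (s := Set.Ioi 0)))
    (eventually_mem_nhdsWithin.mono h)

/-- Optimising Young's inequality over dilations. -/
theorem le_rpow_mul_rpow_of_forall {p q A B U : ℝ} (hp : 0 < p) (hq : 0 < q)
    (hpq : 1 / p + 1 / q = 1) (hA : 0 ≤ A) (hB : 0 ≤ B)
    (h : ∀ s t : ℝ, 0 < s → 0 < t →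
      s * t * U ≤ 1 / p * (s ^ p * A) + 1 / q * (t ^ q * B)) :
    U ≤ A ^ (1 / p) * B ^ (1 / q) := by
  -- The optimal dilations are `A ^ (-1/p)` and `B ^ (-1/q)`; since `A` or `B` may vanish, they are
  -- taken at `A + ε` and `B + ε`, and `ε` tends to `0`.
  have hcont : Continuous fun ε : ℝ => (A + ε) ^ (1 / p) * (B + ε) ^ (1 / q) := by
    refine Continuous.mul ?_ ?_
    · exact (continuous_const.add continuous_id).rpow_const fun _ => Or.inr (by positivity)
    · exact (continuous_const.add continuous_id).rpow_const fun _ => Or.inr (by positivity)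
  have key := le_of_forall_pos_le_of_continuous hcont (U := U) fun ε hε => ?_
  · simpa using key
  have hA' : 0 < A + ε := by positivity
  have hB' : 0 < B + ε := by positivity
  have hs : 0 < (A + ε) ^ (1 / p) := Real.rpow_pos_of_pos hA' _
  have ht : 0 < (B + ε) ^ (1 / q) := Real.rpow_pos_of_pos hB' _
  have aux : ∀ {D e : ℝ}, 0 ≤ D → 0 < D + ε → 0 < e →
      (((D + ε) ^ (1 / e))⁻¹) ^ e * D ≤ 1 := by
    intro D e hD hDε he
    rw [Real.inv_rpow (Real.rpow_nonneg hDε.le _), ← Real.rpow_mul hDε.le,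
      one_div_mul_cancel he.ne', Real.rpow_one, inv_mul_le_iff₀ hDε]
    linarith
  have h1 := h _ _ (inv_pos.2 hs) (inv_pos.2 ht)
  have h2 := mul_le_mul_of_nonneg_left (aux hA hA' hp) (one_div_pos.2 hp).le
  have h3 := mul_le_mul_of_nonneg_left (aux hB hB' hq) (one_div_pos.2 hq).le
  have h4 : ((A + ε) ^ (1 / p))⁻¹ * ((B + ε) ^ (1 / q))⁻¹ * U ≤ 1 := by linarith
  rwa [← mul_inv, inv_mul_le_iff₀ (mul_pos hs ht), mul_one] at h4

/-! ### Positive parts and powers of the space -/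

namespace KotheFunctionSpace

variable {Ω : Type*} [MeasurableSpace Ω] {μ : Measure Ω}

/-- The positive part of an element of the space. -/
noncomputable def pos (X : KotheFunctionSpace μ) (x : X.carrier) : X.carrier :=
  ⟨AEEqFun.mk _ ((x : Ω →ₘ[μ] ℝ).measurable.max measurable_const).aestronglyMeasurable,
    X.mk_mem_of_abs_le (f := fun ω => max ((x : Ω →ₘ[μ] ℝ) ω) 0)
      ((x : Ω →ₘ[μ] ℝ).measurable.max measurable_const) x (Eventually.of_forall fun ω => by
        rw [abs_of_nonneg (le_max_right _ _)]
        exact max_le (le_abs_self _) (abs_nonneg _))⟩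

theorem coeFn_pos (X : KotheFunctionSpace μ) (x : X.carrier) :
    ∀ᵐ ω ∂μ, (X.pos x : Ω →ₘ[μ] ℝ) ω = max ((x : Ω →ₘ[μ] ℝ) ω) 0 :=
  AEEqFun.coeFn_mk _ _

theorem norm_mono (X : KotheFunctionSpace μ) {x y : X.carrier}
    (h : ∀ᵐ ω ∂μ, |(x : Ω →ₘ[μ] ℝ) ω| ≤ |(y : Ω →ₘ[μ] ℝ) ω|) : ‖x‖ ≤ ‖y‖ :=
  X.nrm_mono x y h

theorem norm_pos_le (X : KotheFunctionSpace μ) (x : X.carrier) : ‖X.pos x‖ ≤ ‖x‖ := by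
  refine X.norm_mono ?_
  filter_upwards [X.coeFn_pos x] with ω h
  rw [h, abs_of_nonneg (le_max_right _ _)]
  exact max_le (le_abs_self _) (abs_nonneg _)

theorem pos_of_nonneg (X : KotheFunctionSpace μ) {x : X.carrier}
    (hx : ∀ᵐ ω ∂μ, 0 ≤ (x : Ω →ₘ[μ] ℝ) ω) : X.pos x = x := by
  refine X.carrier_ext ?_
  filter_upwards [X.coeFn_pos x, hx] with ω h1 h2
  rw [h1, max_eq_left h2]

theorem pos_neg_of_nonneg (X : KotheFunctionSpace μ) {x : X.carrier}
    (hx : ∀ᵐ ω ∂μ, 0 ≤ (x : Ω →ₘ[μ] ℝ) ω) : X.pos (-x) = 0 := by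
  refine X.carrier_ext ?_
  filter_upwards [X.coeFn_pos (-x), hx, AEEqFun.coeFn_neg (x : Ω →ₘ[μ] ℝ),
    AEEqFun.coeFn_zero (μ := μ) (β := ℝ)] with ω h1 h2 h3 h4
  have h3' : ((-x : X.carrier) : Ω →ₘ[μ] ℝ) ω = -(x : Ω →ₘ[μ] ℝ) ω := h3
  rw [h1, h3', max_eq_right (neg_nonpos.2 h2)]
  exact h4.symm

theorem pos_zero (X : KotheFunctionSpace μ) : X.pos 0 = 0 :=
  X.pos_of_nonneg (AEEqFun.coeFn_zero.mono fun _ h => h.ge)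

theorem norm_pos_smul (X : KotheFunctionSpace μ) {c : ℝ} (hc : 0 < c) (x : X.carrier) :
    ‖X.pos (c • x)‖ = c * ‖X.pos x‖ := by
  have h : X.pos (c • x) = c • X.pos x := by
    refine X.carrier_ext ?_
    filter_upwards [X.coeFn_pos (c • x), X.coeFn_pos x, X.coeFn_carrier_smul c x,
      X.coeFn_carrier_smul c (X.pos x)] with ω h1 h2 h3 h4
    rw [h1, h3, h4, h2, mul_max_of_nonneg _ _ hc.le, mul_zero]
  rw [h, norm_smul, Real.norm_of_nonneg hc.le]

theorem norm_pos_add_le (X : KotheFunctionSpace μ) (x y : X.carrier) :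
    ‖X.pos (x + y)‖ ≤ ‖X.pos x‖ + ‖X.pos y‖ := by
  refine le_trans (X.norm_mono ?_) (norm_add_le (X.pos x) (X.pos y))
  filter_upwards [X.coeFn_pos (x + y), X.coeFn_pos x, X.coeFn_pos y, X.coeFn_carrier_add x y,
    X.coeFn_carrier_add (X.pos x) (X.pos y)] with ω h1 h2 h3 h4 h5
  rw [h1, h4, h5, h2, h3, abs_of_nonneg (le_max_right _ _),
    abs_of_nonneg (add_nonneg (le_max_right _ _) (le_max_right _ _))]
  exact max_le (add_le_add (le_max_left _ _) (le_max_left _ _))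
    (add_nonneg (le_max_right _ _) (le_max_right _ _))

/-- A linear functional dominated by the norm of the positive part is a positive functional of
norm at most one. -/
theorem exists_isPositive_of_le_norm_pos (X : KotheFunctionSpace μ) (L : X.carrier →ₗ[ℝ] ℝ)
    (hL : ∀ x, L x ≤ ‖X.pos x‖) :
    ∃ φ : StrongDual ℝ X.carrier, X.IsPositive φ ∧ ‖φ‖ ≤ 1 ∧ ∀ x, φ x = L x := by
  have hb : ∀ x, ‖L x‖ ≤ 1 * ‖x‖ := by
    intro x
    rw [one_mul, Real.norm_eq_abs, abs_le]
    have h1 := (hL x).trans (X.norm_pos_le x)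
    have h2 := (hL (-x)).trans (X.norm_pos_le (-x))
    rw [map_neg, norm_neg] at h2
    exact ⟨by linarith, h1⟩
  refine ⟨L.mkContinuous 1 hb, fun x hx => ?_, L.mkContinuous_norm_le zero_le_one hb,
    fun x => rfl⟩
  have h := hL (-x)
  rw [X.pos_neg_of_nonneg hx, norm_zero, map_neg] at h
  change 0 ≤ L x
  linarith

theorem coeFn_rootPow (X : KotheFunctionSpace μ) (p : ℝ≥0∞) [Fact (1 ≤ p)] (hp : p ≠ ∞)
    (x : X.root p) : ∀ᵐ ω ∂μ, (X.rootPow p hp x : Ω →ₘ[μ] ℝ) ω =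
      |(x : Ω →ₘ[μ] ℝ) ω| ^ p.toReal :=
  coeFn_absPow _ _

theorem rootPow_nonneg (X : KotheFunctionSpace μ) (p : ℝ≥0∞) [Fact (1 ≤ p)] (hp : p ≠ ∞)
    (x : X.root p) : ∀ᵐ ω ∂μ, 0 ≤ (X.rootPow p hp x : Ω →ₘ[μ] ℝ) ω :=
  (X.coeFn_rootPow p hp x).mono fun ω h => by rw [h]; positivity

theorem rootPow_smul (X : KotheFunctionSpace μ) (p : ℝ≥0∞) [Fact (1 ≤ p)] (hp : p ≠ ∞)
    {c : ℝ} (hc : 0 ≤ c) (x : X.root p) :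
    X.rootPow p hp (c • x) = c ^ p.toReal • X.rootPow p hp x := by
  refine X.carrier_ext ?_
  filter_upwards [X.coeFn_rootPow p hp (c • x), X.coeFn_rootPow p hp x,
    X.coeFn_carrier_smul (c ^ p.toReal) (X.rootPow p hp x),
    AEEqFun.coeFn_smul c (x : Ω →ₘ[μ] ℝ)] with ω h1 h2 h3 h4
  have h4' : ((c • x : X.root p) : Ω →ₘ[μ] ℝ) ω = c * (x : Ω →ₘ[μ] ℝ) ω := h4
  rw [h1, h3, h2, h4', abs_mul, abs_of_nonneg hc, Real.mul_rpow hc (abs_nonneg _)]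

/-- This absorbs a nonnegative weight in `X` into the vector of `X^{1/p}`. -/
theorem rootPow_rpow_smul (X : KotheFunctionSpace μ) (p : ℝ≥0∞) [Fact (1 ≤ p)] (hp : p ≠ ∞)
    {c : ℝ} (hc : 0 ≤ c) (x : X.root p) :
    X.rootPow p hp (c ^ (1 / p.toReal) • x) = c • X.rootPow p hp x := by
  rw [X.rootPow_smul p hp (Real.rpow_nonneg hc _), ← Real.rpow_mul hc,
    one_div_mul_cancel (toReal_pos_of_one_le p hp).ne', Real.rpow_one]

theorem rootPow_rootSum (X : KotheFunctionSpace μ) (p : ℝ≥0∞) [Fact (1 ≤ p)] (hp : p ≠ ∞)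
    {n : ℕ} (x : Fin n → X.root p) :
    X.rootPow p hp (X.rootSum p x) = ∑ k, X.rootPow p hp (x k) := by
  refine X.carrier_ext ?_
  filter_upwards [X.coeFn_rootPow p hp (X.rootSum p x),
    coeFn_lpSum p (fun k => (x k : Ω →ₘ[μ] ℝ)),
    X.coeFn_carrier_sum Finset.univ fun k => X.rootPow p hp (x k),
    ae_all_iff.2 fun k => X.coeFn_rootPow p hp (x k)] with ω h1 h2 h3 h4
  have h2' : (X.rootSum p x : Ω →ₘ[μ] ℝ) ω = lpSumFun p (fun k => (x k : Ω →ₘ[μ] ℝ)) ω := h2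
  have h0 : 0 ≤ ∑ k, |(x k : Ω →ₘ[μ] ℝ) ω| ^ p.toReal :=
    Finset.sum_nonneg fun _ _ => by positivity
  rw [h1, h2', h3]
  simp only [lpSumFun, if_neg hp, h4]
  rw [abs_of_nonneg (Real.rpow_nonneg h0 _), ← Real.rpow_mul h0,
    one_div_mul_cancel (toReal_pos_of_one_le p hp).ne', Real.rpow_one]

/-- The sum of powers is nonnegative, so its positive part can be inserted to match the sublinear
functional used for domination. -/
theorem rootNorm_rootSum (X : KotheFunctionSpace μ) (p : ℝ≥0∞) [Fact (1 ≤ p)] (hp : p ≠ ∞)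
    {n : ℕ} (x : Fin n → X.root p) :
    X.rootNorm p (X.rootSum p x) =
      ‖X.pos (∑ k, X.rootPow p hp (x k))‖ ^ (1 / p.toReal) := by
  rw [rootNorm, dif_neg hp, X.rootPow_rootSum p hp x, X.pos_of_nonneg]
  rw [← X.rootPow_rootSum p hp x]
  exact X.rootPow_nonneg p hp _

theorem rootNorm_top_smul (X : KotheFunctionSpace μ) (p : ℝ≥0∞) [Fact (1 ≤ p)] (hp : p = ∞)
    {c : ℝ} (hc : 0 ≤ c) (x : X.root p) : X.rootNorm p (c • x) = c * X.rootNorm p x := by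
  have h : eLpNorm ((c • x : X.root p) : Ω →ₘ[μ] ℝ) ∞ μ =
      eLpNorm (c • ((x : Ω →ₘ[μ] ℝ) : Ω → ℝ)) ∞ μ :=
    eLpNorm_congr_ae (AEEqFun.coeFn_smul c (x : Ω →ₘ[μ] ℝ))
  rw [rootNorm, rootNorm, dif_pos hp, dif_pos hp, h, eLpNorm_const_smul, ENNReal.toReal_mul,
    toReal_enorm, Real.norm_of_nonneg hc]

/-- A finite maximum of functions bounded by one almost everywhere is again so bounded; the empty
maximum is `0`. -/
theorem rootNorm_top_rootSum_le_one (X : KotheFunctionSpace μ) (p : ℝ≥0∞) [Fact (1 ≤ p)]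
    (hp : p = ∞) {n : ℕ} (x : Fin n → X.root p) (hx : ∀ k, X.rootNorm p (x k) ≤ 1) :
    X.rootNorm p (X.rootSum p x) ≤ 1 := by
  have hb : ∀ k, ∀ᵐ ω ∂μ, |(x k : Ω →ₘ[μ] ℝ) ω| ≤ 1 := by
    intro k
    have h1 := hx k
    rw [rootNorm, dif_pos hp] at h1
    have h2 : eLpNorm (x k : Ω →ₘ[μ] ℝ) ∞ μ ≤ 1 := by
      have := ((X.mem_root_top p hp _).1 (x k).2).eLpNorm_ne_top
      rw [← ENNReal.ofReal_toReal this]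
      exact ENNReal.ofReal_le_one.2 h1
    rw [eLpNorm_exponent_top] at h2
    filter_upwards [ae_le_eLpNormEssSup (f := (x k : Ω →ₘ[μ] ℝ)) (μ := μ)] with ω hω
    have h3 := hω.trans h2
    rw [← ofReal_norm, ENNReal.ofReal_le_one] at h3
    exact h3
  rw [rootNorm, dif_pos hp]
  refine ENNReal.toReal_le_of_le_ofReal zero_le_one ?_
  rw [eLpNorm_exponent_top]
  refine eLpNormEssSup_le_of_ae_bound ?_
  filter_upwards [ae_all_iff.2 hb, coeFn_lpSum p (fun k => (x k : Ω →ₘ[μ] ℝ))] with ω h1 h2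
  have h2' : (X.rootSum p x : Ω →ₘ[μ] ℝ) ω = lpSumFun p (fun k => (x k : Ω →ₘ[μ] ℝ)) ω := h2
  rw [h2', lpSumFun, if_pos hp, Real.norm_eq_abs,
    abs_of_nonneg (Real.iSup_nonneg fun _ => abs_nonneg _)]
  exact Real.iSup_le h1 zero_le_one

end KotheFunctionSpace

theorem IsHomogeneousForm.norm_smul_smul {𝕜 E F : Type*} [RCLike 𝕜] [AddCommGroup E] [Module ℝ E]
    [AddCommGroup F] [Module ℝ F] {u : E → F → 𝕜} (hu : IsHomogeneousForm u) {s t : ℝ}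
    (hs : 0 ≤ s) (ht : 0 ≤ t) (x : E) (y : F) : ‖u (s • x) (t • y)‖ = s * t * ‖u x y‖ := by
  rw [(hu s x (t • y) hs).1, (hu t x y ht).2, norm_mul, norm_mul, RCLike.norm_ofReal,
    RCLike.norm_ofReal, abs_of_nonneg hs, abs_of_nonneg ht, mul_assoc]

/-! ### Domination by positive functionals -/

namespace KotheFunctionSpace

/-- Domination of a homogeneous form by positive functionals, for finite conjugate exponents. -/
theorem exists_isPositive_dominating {𝕜 : Type*} [RCLike 𝕜]
    {Ω : Type*} [MeasurableSpace Ω] {μ : Measure Ω} {Ω' : Type*} [MeasurableSpace Ω']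
    {ν : Measure Ω'} (X : KotheFunctionSpace μ) (Y : KotheFunctionSpace ν)
    (r r' : ℝ≥0∞) [Fact (1 ≤ r)] [Fact (1 ≤ r')] (hr : r ≠ ∞) (hr' : r' ≠ ∞)
    (hrr' : r⁻¹ + r'⁻¹ = 1) {u : X.root r → Y.root r' → 𝕜} (hu : IsHomogeneousForm u)
    (hsum : ∀ (n : ℕ) (x : Fin n → X.root r) (y : Fin n → Y.root r'),
      ∑ k, ‖u (x k) (y k)‖ ≤
        X.rootNorm r (X.rootSum r x) * Y.rootNorm r' (Y.rootSum r' y)) :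
    ∃ (φ : StrongDual ℝ X.carrier) (ψ : StrongDual ℝ Y.carrier),
      X.IsPositive φ ∧ ‖φ‖ ≤ 1 ∧ Y.IsPositive ψ ∧ ‖ψ‖ ≤ 1 ∧
      ∀ (x : X.root r) (y : Y.root r'),
        ‖u x y‖ ≤ X.rootEval r φ x * Y.rootEval r' ψ y := by
  have hp := toReal_pos_of_one_le r hr
  have hq := toReal_pos_of_one_le r' hr'
  have hpq : 1 / r.toReal + 1 / r'.toReal = 1 := by
    have h := congrArg ENNReal.toReal hrr'
    have h1 : r⁻¹ ≠ ∞ := ne_top_of_le_ne_top ENNReal.one_ne_top (hrr' ▸ le_self_add)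
    have h2 : r'⁻¹ ≠ ∞ := ne_top_of_le_ne_top ENNReal.one_ne_top (hrr' ▸ le_add_self)
    rw [ENNReal.toReal_add h1 h2, ENNReal.toReal_inv, ENNReal.toReal_inv,
      ENNReal.toReal_one] at h
    simpa only [one_div] using h
  set p := r.toReal with hpdef
  set q := r'.toReal with hqdef
  have hp' : 0 < 1 / p := one_div_pos.2 hp
  have hq' : 0 < 1 / q := one_div_pos.2 hq
  obtain ⟨Φ, hΦ, hΦu⟩ := exists_linear_le_sublinear_of_family
    (E := X.carrier × Y.carrier) (I := X.root r × Y.root r')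
    (fun z => 1 / p * ‖X.pos z.1‖ + 1 / q * ‖Y.pos z.2‖)
    (by
      intro c hc z
      simp only [Prod.smul_fst, Prod.smul_snd, X.norm_pos_smul hc, Y.norm_pos_smul hc]
      ring)
    (by
      intro z w
      have h1 := mul_le_mul_of_nonneg_left (X.norm_pos_add_le z.1 w.1) hp'.le
      have h2 := mul_le_mul_of_nonneg_left (Y.norm_pos_add_le z.2 w.2) hq'.le
      simp only [Prod.fst_add, Prod.snd_add]
      linarith)
    (fun i => (X.rootPow r hr i.1, Y.rootPow r' hr' i.2)) (fun i => ‖u i.1 i.2‖)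
    (by
      intro n t i ht
      -- As `1/p + 1/q = 1`, homogeneity extracts exactly the factor `t k` from each term.
      have h := hsum n (fun k => (t k) ^ (1 / p) • (i k).1) (fun k => (t k) ^ (1 / q) • (i k).2)
      rw [X.rootNorm_rootSum r hr, Y.rootNorm_rootSum r' hr'] at h
      have e1 : ∑ k, ‖u ((t k) ^ (1 / p) • (i k).1) ((t k) ^ (1 / q) • (i k).2)‖ =
          ∑ k, t k * ‖u (i k).1 (i k).2‖ := by
        refine Finset.sum_congr rfl fun k _ => ?_
        rw [hu.norm_smul_smul (Real.rpow_nonneg (ht k) _) (Real.rpow_nonneg (ht k) _),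
          ← Real.rpow_add' (ht k) (by rw [hpq]; exact one_ne_zero), hpq, Real.rpow_one]
      rw [e1] at h
      simp only [hpdef, hqdef, X.rootPow_rpow_smul r hr (ht _),
        Y.rootPow_rpow_smul r' hr' (ht _)] at h
      simp only [Prod.fst_sum, Prod.snd_sum, Prod.smul_fst, Prod.smul_snd]
      exact h.trans (Real.geom_mean_le_arith_mean2_weighted hp'.le hq'.le (norm_nonneg _)
        (norm_nonneg _) hpq))
  obtain ⟨φ, hφ, hφ1, hφe⟩ := X.exists_isPositive_of_le_norm_pos
    -- The factor `p` cancels the weight `1 / p` in the sublinear bound, leaving `‖x⁺‖`.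
    (p • Φ.comp (LinearMap.inl ℝ X.carrier Y.carrier)) (by
      intro x
      have h := mul_le_mul_of_nonneg_left (hΦ (x, 0)) hp.le
      simp only [Y.pos_zero, norm_zero, mul_zero, add_zero] at h
      rwa [← mul_assoc, mul_one_div_cancel hp.ne', one_mul] at h)
  obtain ⟨ψ, hψ, hψ1, hψe⟩ := Y.exists_isPositive_of_le_norm_pos
    (q • Φ.comp (LinearMap.inr ℝ X.carrier Y.carrier)) (by
      intro y
      have h := mul_le_mul_of_nonneg_left (hΦ (0, y)) hq.le
      simp only [X.pos_zero, norm_zero, mul_zero, zero_add] at h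
      rwa [← mul_assoc, mul_one_div_cancel hq.ne', one_mul] at h)
  refine ⟨φ, ψ, hφ, hφ1, hψ, hψ1, fun x y => ?_⟩
  have hsplit : ∀ x y, Φ (x, y) = 1 / p * φ x + 1 / q * ψ y := by
    intro x y
    have e1 : φ x = p * Φ (x, 0) := hφe x
    have e2 : ψ y = q * Φ (0, y) := hψe y
    have e3 : ((x, y) : X.carrier × Y.carrier) = (x, 0) + (0, y) := by simp
    rw [e1, e2, e3, map_add, ← mul_assoc, ← mul_assoc, one_div_mul_cancel hp.ne',
      one_div_mul_cancel hq.ne', one_mul, one_mul]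
  rw [rootEval, rootEval, dif_neg hr, dif_neg hr']
  refine le_rpow_mul_rpow_of_forall hp hq hpq (hφ _ (X.rootPow_nonneg r hr x))
    (hψ _ (Y.rootPow_nonneg r' hr' y)) fun s t hs ht => ?_
  -- Dilating both variables supplies the family of Young-type inequalities from which the product
  -- bound follows.
  have h := hΦu (s • x, t • y)
  simp only [hsplit, X.rootPow_smul r hr hs.le, Y.rootPow_smul r' hr' ht.le, map_smul,
    smul_eq_mul, hu.norm_smul_smul hs.le ht.le] at h
  exact h

/-- Domination of a homogeneous form by a positive functional, for the exponents `1` and `∞`. -/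
theorem exists_isPositive_dominating_one_top {𝕜 : Type*} [RCLike 𝕜]
    {Ω : Type*} [MeasurableSpace Ω] {μ : Measure Ω} {Ω' : Type*} [MeasurableSpace Ω']
    {ν : Measure Ω'} (X : KotheFunctionSpace μ) (Y : KotheFunctionSpace ν)
    (r r' : ℝ≥0∞) [Fact (1 ≤ r)] [Fact (1 ≤ r')] (hr : r = 1) (hr' : r' = ∞)
    {u : X.root r → Y.root r' → 𝕜} (hu : IsHomogeneousForm u)
    (hsum : ∀ (n : ℕ) (x : Fin n → X.root r) (y : Fin n → Y.root r'),
      ∑ k, ‖u (x k) (y k)‖ ≤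
        X.rootNorm r (X.rootSum r x) * Y.rootNorm r' (Y.rootSum r' y)) :
    ∃ φ : StrongDual ℝ X.carrier, X.IsPositive φ ∧ ‖φ‖ ≤ 1 ∧
      ∀ (x : X.root r) (y : Y.root r'), ‖u x y‖ ≤ X.rootEval r φ x * Y.rootNorm r' y := by
  have hrt : r ≠ ∞ := hr ▸ ENNReal.one_ne_top
  have hp : r.toReal = 1 := by rw [hr, ENNReal.toReal_one]
  obtain ⟨Φ, hΦ, hΦu⟩ := exists_linear_le_sublinear_of_family
    (E := X.carrier) (I := X.root r × {y : Y.root r' // Y.rootNorm r' y ≤ 1})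
    (fun z => ‖X.pos z‖) (fun c hc z => X.norm_pos_smul hc z) X.norm_pos_add_le
    (fun i => X.rootPow r hrt i.1) (fun i => ‖u i.1 i.2‖)
    (by
      intro n t i ht
      -- With `r = 1` the whole weight goes to the first variable, so the second stays in the unit
      -- ball of `L_∞`.
      have h := hsum n (fun k => t k • (i k).1) (fun k => (i k).2)
      have e1 : ∑ k, ‖u (t k • (i k).1) (i k).2‖ = ∑ k, t k * ‖u (i k).1 (i k).2‖ := by
        refine Finset.sum_congr rfl fun k _ => ?_
        rw [(hu _ _ _ (ht k)).1, norm_mul, RCLike.norm_ofReal, abs_of_nonneg (ht k)]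
      rw [e1, X.rootNorm_rootSum r hrt] at h
      simp only [X.rootPow_smul r hrt (ht _), hp, Real.rpow_one, div_one] at h
      exact h.trans (mul_le_of_le_one_right (norm_nonneg _)
        (Y.rootNorm_top_rootSum_le_one r' hr' _ fun k => (i k).2.2)))
  obtain ⟨φ, hφ, hφ1, hφe⟩ := X.exists_isPositive_of_le_norm_pos Φ hΦ
  refine ⟨φ, hφ, hφ1, fun x y => ?_⟩
  have hN : 0 ≤ Y.rootNorm r' y := by
    rw [rootNorm, dif_pos hr']; exact ENNReal.toReal_nonneg
  rw [rootEval, dif_neg hrt, hp, div_one, Real.rpow_one]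
  -- The norm of `y` may be zero, so `y` is normalised by `‖y‖ + ε` and `ε` tends to `0`.
  have hcont : Continuous fun ε : ℝ => φ (X.rootPow r hrt x) * (Y.rootNorm r' y + ε) := by
    fun_prop
  have key := le_of_forall_pos_le_of_continuous hcont (U := ‖u x y‖) fun ε hε => ?_
  · simpa using key
  have hpos : 0 < Y.rootNorm r' y + ε := by positivity
  have hy : Y.rootNorm r' ((Y.rootNorm r' y + ε)⁻¹ • y) ≤ 1 := by
    rw [Y.rootNorm_top_smul r' hr' (inv_nonneg.2 hpos.le), inv_mul_le_iff₀ hpos]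
    linarith
  have h := hΦu (x, ⟨_, hy⟩)
  simp only at h
  rw [← hφe, (hu _ _ _ (inv_nonneg.2 hpos.le)).2, norm_mul, RCLike.norm_ofReal,
    abs_of_nonneg (inv_nonneg.2 hpos.le), inv_mul_le_iff₀ hpos, mul_comm] at h
  exact h

end KotheFunctionSpace

theorem corollary1 {𝕜 : Type*} [RCLike 𝕜]
    {Ω : Type*} [MeasurableSpace Ω] (μ : Measure Ω) [SigmaFinite μ] [μ.IsComplete]
    {Ω' : Type*} [MeasurableSpace Ω'] (ν : Measure Ω') [SigmaFinite ν] [ν.IsComplete]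
    (X : KotheFunctionSpace μ) (Y : KotheFunctionSpace ν)
    (r r' : ℝ≥0∞) [Fact (1 ≤ r)] [Fact (1 ≤ r')] (hr : r ≠ ∞) (hrr' : r⁻¹ + r'⁻¹ = 1)
    (u : X.root r → Y.root r' → 𝕜) (hu : IsHomogeneousForm u)
    (hsum : ∀ (n : ℕ) (x : Fin n → X.root r) (y : Fin n → Y.root r'),
      ∑ k, ‖u (x k) (y k)‖ ≤
        X.rootNorm r (X.rootSum r x) * Y.rootNorm r' (Y.rootSum r' y)) :
    ∃ (φ : StrongDual ℝ X.carrier) (ψ : StrongDual ℝ Y.carrier),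
      X.IsPositive φ ∧ ‖φ‖ ≤ 1 ∧ Y.IsPositive ψ ∧ ‖ψ‖ ≤ 1 ∧
      (∀ (x : X.root r) (y : Y.root r'),
        ‖u x y‖ ≤ X.rootEval r φ x * Y.rootEval r' ψ y) ∧
      (X.SigmaOrderContinuous → X.IsFunctionInKotheDual φ) ∧
      (Y.SigmaOrderContinuous → Y.IsFunctionInKotheDual ψ) := by
  obtain ⟨φ, ψ, hφ, hφ1, hψ, hψ1, h⟩ : ∃ (φ : StrongDual ℝ X.carrier)
      (ψ : StrongDual ℝ Y.carrier), X.IsPositive φ ∧ ‖φ‖ ≤ 1 ∧ Y.IsPositive ψ ∧ ‖ψ‖ ≤ 1 ∧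
      ∀ (x : X.root r) (y : Y.root r'),
        ‖u x y‖ ≤ X.rootEval r φ x * Y.rootEval r' ψ y := by
    by_cases hr' : r' = ∞
    · have hr1 : r = 1 := by simpa [hr'] using hrr'
      obtain ⟨φ, hφ, hφ1, h⟩ :=
        X.exists_isPositive_dominating_one_top Y r r' hr1 hr' hu hsum
      -- For `r' = ∞` the second factor is the `L_∞` norm whatever `ψ` is, so the zero functional
      -- serves.
      refine ⟨φ, 0, hφ, hφ1, fun _ _ => le_rfl, by simp, fun x y => (h x y).trans_eq ?_⟩
      rw [KotheFunctionSpace.rootEval, KotheFunctionSpace.rootNorm, KotheFunctionSpace.rootEval,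
        dif_pos hr', dif_pos hr']
    · exact X.exists_isPositive_dominating Y r r' hr hr' hrr' hu hsum
  exact ⟨φ, ψ, hφ, hφ1, hψ, hψ1, h, fun hX => hX.isFunctionInKotheDual hφ,
    fun hY => hY.isFunctionInKotheDual hψ⟩
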